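/- A \emph{quasi-metric space} is a set $X$ with a map $d\colon X\times X\to\mathbb{R}_{\ge 0}$ such that, for all $x,y,z\in X$, $d(x,y)\le d(x,z)+d(z,y)$, and $d(x,y)=d(y,x)=0$ if and only if $x=y$. Put $d^s(x,y)=\max\{d(x,y),d(y,x)\}$. The space is \emph{bounded} if $\sup\{d(x,y)\mid x,y\in X\}<\infty$, and a map $T\colon X\to X$ is \emph{non-expansive} if $d(T(x),T(y))\le d(x,y)$ for all $x,y\in X$. For $\delta\ge 0$, the space $X$ is \emph{$\delta$-$\mathrm{Sym}$-coarsely injective} if, for every (possibly empty) family $\{(x_i,r_i,s_i)\}_{i\in I}$ in $X\times\mathbb{R}_{\ge 0}\times\mathbb{R}_{\ge 0}$ satisfying $d(x_i,x_j)\le r_i+s_j$ for all $i,j\in I$, there exists $z\in X$ such that $d(x_i,z)\le r_i+\delta$ and $d(z,x_i)\le s_i+\delta$ for all $i\in I$. (The empty family shows that such a space is non-empty.) \textbf{Corollary.} Let $\delta\ge 0$, let $(X,d)$ be a bounded $\delta$-$\mathrm{Sym}$-coarsely injective quasi-metric space, and let $T\colon X\to X$ be a non-expansive map. Then there exists $x\in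 X$ with $d^s(x,T(x))\le 2\delta$. -/

import Mathlib

universe u

namespace QuasiMetric

/-- `d` is a quasi-metric on `X`: a finite, nonnegative distance satisfying the triangle inequality
and separating points in the `T₀` sense, but not necessarily symmetric. -/
structure IsQuasiMetric {X : Type u} (d : X → X → ℝ) : Prop where
  nonneg : ∀ x y, 0 ≤ d x y
  zero_iff : ∀ x y, (d x y = 0 ∧ d y x = 0) ↔ x = y
  triangle : ∀ x y z, d x y ≤ d x z + d z y

/-- The conjugate `d⁻¹(x, y) = d(y, x)`. -/
def conj {X : Type u} (d : X → X → ℝ) : X → X → ℝ := fun x y => d y x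

/-- The symmetrisation `dˢ(x, y) = max {d(x, y), d(y, x)}`. -/
def symm {X : Type u} (d : X → X → ℝ) : X → X → ℝ := fun x y => max (d x y) (conj d x y)

/-- The ball `C_d(x, r) = {y | d(x, y) ≤ r}`. -/
def closedBall {X : Type u} (d : X → X → ℝ) (x : X) (r : ℝ) : Set X := {y | d x y ≤ r}

/-- Boundedness: the supremum of `d(x, y)` over all `x, y` is finite. -/
def IsBounded {X : Type u} (d : X → X → ℝ) : Prop :=
  BddAbove (Set.range fun p : X × X => d p.1 p.2)

/-- A map between quasi-metric spaces that does not increase distances. -/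
def NonExpansive {X Y : Type u} (dX : X → X → ℝ) (dY : Y → Y → ℝ) (f : X → Y) : Prop :=
  ∀ x y, dY (f x) (f y) ≤ dX x y

/-- `δ`-`Sym`-coarse injectivity. The index type ranges over the universe of `X`; this covers all
families, as the condition depends only on the set of triples `(x i, r i, s i)`, which is a subset
of `X × ℝ × ℝ`. The intersection of the empty family is all of `X`. -/
def IsSymCoarselyInjective {X : Type u} (d : X → X → ℝ) (δ : ℝ) : Prop :=
  ∀ (ι : Type u) (x : ι → X) (r s : ι → ℝ), (∀ i, 0 ≤ r i) → (∀ i, 0 ≤ s i) →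
    (∀ i j, d (x i) (x j) ≤ r i + s j) →
    (⋂ i, closedBall d (x i) (r i + δ) ∩ closedBall (conj d) (x i) (s i + δ)).Nonempty

end QuasiMetric

open scoped ENNReal

namespace QuasiMetric

section Isbell

variable {X : Type u} (D : X → X → ℝ≥0∞)

/-! Mutually conjugate pairs `(r, s)` are the points of the Isbell hull. `T` acts monotonically on
their first coordinates, so Knaster–Tarski gives a fixed pair, and neither `r` nor `s` increases
along `T`. Boundedness makes the pair finite, so coarse injectivity realises it up to `δ` by some
`z`. Conjugacy then forces `r z, s z ≤ δ`, hence `r (T z), s (T z) ≤ δ`, and `z` is within `δ + δ`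
of `T z` both ways. -/

/-- The Isbell conjugate of `r`: the least `s` with `D x y ≤ r x + s y` for all `x`, `y`. -/
noncomputable def isbellDual (r : X → ℝ≥0∞) : X → ℝ≥0∞ := fun y => ⨆ x, D x y - r x

/-- The extension of `r` along `T`: the distances to the image under `T` of a point whose
distances from `X` are given by `r`. -/
noncomputable def pushforward (T : X → X) (r : X → ℝ≥0∞) : X → ℝ≥0∞ :=
  fun z => ⨅ x, D z (T x) + r x

variable {D}

theorem isbellDual_le_iff {r s : X → ℝ≥0∞} :
    isbellDual D r ≤ s ↔ ∀ x y, D x y ≤ r x + s y := by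
  simp only [Pi.le_def, isbellDual, iSup_le_iff, tsub_le_iff_left]
  exact forall_comm

theorem le_add_isbellDual (r : X → ℝ≥0∞) (x y : X) : D x y ≤ r x + isbellDual D r y :=
  isbellDual_le_iff.1 le_rfl x y

theorem isbellDual_anti : Antitone (isbellDual D) := fun _ _ h _ =>
  iSup_mono fun x => tsub_le_tsub_left (h x) _

theorem isbellDual_swap_isbellDual_le (r : X → ℝ≥0∞) :
    isbellDual (Function.swap D) (isbellDual D r) ≤ r :=
  isbellDual_le_iff.2 fun y x => (le_add_isbellDual r x y).trans_eq (add_comm _ _)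

theorem isbellDual_isbellDual_isbellDual (r : X → ℝ≥0∞) :
    isbellDual D (isbellDual (Function.swap D) (isbellDual D r)) = isbellDual D r :=
  le_antisymm (isbellDual_swap_isbellDual_le (D := Function.swap D) _)
    (isbellDual_anti (isbellDual_swap_isbellDual_le r))

theorem pushforward_mono (T : X → X) : Monotone (pushforward D T) := fun _ _ h _ =>
  iInf_mono fun x => add_le_add_right (h x) _

theorem pushforward_le {T : X → X} (h0 : ∀ x, D x x = 0) (r : X → ℝ≥0∞) (x : X) :
    pushforward D T r (T x) ≤ r x :=
  (iInf_le _ x).trans_eq (by rw [h0, zero_add])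

/-- Follow the chain `z → T x → T y → w`; non-expansiveness bounds the middle leg by `D x y`. -/
theorem isbellDual_pushforward_le (htri : ∀ x y z, D x y ≤ D x z + D z y) {T : X → X}
    (hT : ∀ x y, D (T x) (T y) ≤ D x y) (r : X → ℝ≥0∞) :
    isbellDual D (pushforward D T r) ≤ pushforward (Function.swap D) T (isbellDual D r) := by
  refine isbellDual_le_iff.2 fun z w => ?_
  simp only [pushforward, ENNReal.iInf_add, ENNReal.add_iInf, le_iInf_iff]
  intro y x
  calc D z w ≤ D z (T x) + (D (T x) (T y) + D (T y) w) :=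
        (htri z w (T x)).trans (by gcongr; exact htri _ _ _)
    _ ≤ D z (T x) + ((r x + isbellDual D r y) + D (T y) w) := by
        gcongr; exact (hT x y).trans (le_add_isbellDual r x y)
    _ = D z (T x) + r x + (Function.swap D w (T y) + isbellDual D r y) := by
        simp only [Function.swap]; ring

/-- A non-expansive map has a fixed point in the Isbell hull: the induced map on the hull is
order preserving, and the hull is a complete lattice. -/
theorem exists_isbell_pair_invariant (h0 : ∀ x, D x x = 0)
    (htri : ∀ x y z, D x y ≤ D x z + D z y) {T : X → X}
    (hT : ∀ x y, D (T x) (T y) ≤ D x y) :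
    ∃ r s : X → ℝ≥0∞, isbellDual D r = s ∧ isbellDual (Function.swap D) s = r ∧
      (∀ x, r (T x) ≤ r x) ∧ ∀ x, s (T x) ≤ s x := by
  -- The pushforward need not lie in the hull; the double conjugate puts it back. Values in `ℝ≥0∞`
  -- make the lattice complete.
  let F : (X → ℝ≥0∞) →o (X → ℝ≥0∞) :=
    ⟨fun r => isbellDual (Function.swap D) (isbellDual D (pushforward D T r)),
      fun _ _ h => isbellDual_anti (isbellDual_anti (pushforward_mono T h))⟩
  obtain ⟨r, hr⟩ : ∃ r, isbellDual (Function.swap D) (isbellDual D (pushforward D T r)) = r :=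
    ⟨F.lfp, F.map_lfp⟩
  have hs : isbellDual D r = isbellDual D (pushforward D T r) := by
    conv_lhs => rw [← hr]
    exact isbellDual_isbellDual_isbellDual _
  refine ⟨r, isbellDual D r, rfl, by rw [hs, hr], fun x => ?_, fun x => ?_⟩
  · have h := isbellDual_swap_isbellDual_le (D := D) (pushforward D T r) (T x)
    rw [hr] at h
    exact h.trans (pushforward_le h0 r x)
  · have h := isbellDual_pushforward_le htri hT r (T x)
    rw [← hs] at h
    exact h.trans (pushforward_le (D := Function.swap D) h0 _ x)

theorem isbellDual_ne_top {C : ℝ≥0∞} (hC : C ≠ ∞) (hD : ∀ x y, D x y ≤ C) (r : X → ℝ≥0∞)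
    (y : X) :
    isbellDual D r y ≠ ∞ :=
  ne_top_of_le_ne_top hC (iSup_le fun x => tsub_le_self.trans (hD x y))

end Isbell

end QuasiMetric

open QuasiMetric in
theorem mainTheorem7 {X : Type u} (d : X → X → ℝ) (hd : QuasiMetric.IsQuasiMetric d)
    (hbdd : QuasiMetric.IsBounded d) (δ : ℝ) (hδ : 0 ≤ δ)
    (hinj : QuasiMetric.IsSymCoarselyInjective d δ)
    (T : X → X) (hT : QuasiMetric.NonExpansive d d T) :
    ∃ x : X, QuasiMetric.symm d x (T x) ≤ 2 * δ := by
  obtain ⟨C, hC⟩ := hbdd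
  have hdC : ∀ x y, d x y ≤ C := fun x y => hC ⟨(x, y), rfl⟩
  let D : X → X → ℝ≥0∞ := fun x y => ENNReal.ofReal (d x y)
  have hDC : ∀ x y, D x y ≤ ENNReal.ofReal C := fun x y => ENNReal.ofReal_le_ofReal (hdC x y)
  obtain ⟨r, s, hrs, hsr, hrT, hsT⟩ := exists_isbell_pair_invariant (D := D) (T := T)
    (fun x => by simp [D, ((hd.zero_iff x x).2 rfl).1])
    (fun x y z => by
      simp only [D]
      rw [← ENNReal.ofReal_add (hd.nonneg _ _) (hd.nonneg _ _)]
      exact ENNReal.ofReal_le_ofReal (hd.triangle x y z))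
    (fun x y => ENNReal.ofReal_le_ofReal (hT x y))
  have hr : ∀ x, r x ≠ ∞ := fun x =>
    hsr ▸ isbellDual_ne_top ENNReal.ofReal_ne_top (fun x y => hDC y x) s x
  have hs : ∀ x, s x ≠ ∞ := fun x => hrs ▸ isbellDual_ne_top ENNReal.ofReal_ne_top hDC r x
  obtain ⟨z, hz⟩ := hinj X id (fun x => (r x).toReal) (fun x => (s x).toReal)
    (fun _ => ENNReal.toReal_nonneg) (fun _ => ENNReal.toReal_nonneg) fun x y => by
      rw [← ENNReal.toReal_add (hr x) (hs y)]
      refine (ENNReal.ofReal_le_iff_le_toReal (ENNReal.add_ne_top.2 ⟨hr x, hs y⟩)).1 ?_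
      exact isbellDual_le_iff.1 hrs.le x y
  simp only [Set.mem_iInter, Set.mem_inter_iff, closedBall, Set.mem_ofPred_eq, id, conj] at hz
  have key : ∀ {a : ℝ} {b : ℝ≥0∞}, b ≠ ∞ → a ≤ b.toReal + δ →
      ENNReal.ofReal a ≤ b + ENNReal.ofReal δ := fun {a b} hb h => by
    rw [← ENNReal.ofReal_toReal hb, ← ENNReal.ofReal_add ENNReal.toReal_nonneg hδ]
    exact ENNReal.ofReal_le_ofReal h
  -- `s z` is the supremum of `D x z - r x`, and each term is at most `δ` by the choice of `z`.
  have hsz : s z ≤ ENNReal.ofReal δ := by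
    rw [← hrs]
    exact iSup_le fun x => tsub_le_iff_left.2 (key (hr x) (hz x).1)
  have hrz : r z ≤ ENNReal.ofReal δ := by
    rw [← hsr]
    exact iSup_le fun x => tsub_le_iff_left.2 (key (hs x) (hz x).2)
  have h1 : (r (T z)).toReal ≤ δ := ENNReal.toReal_le_of_le_ofReal hδ ((hrT z).trans hrz)
  have h2 : (s (T z)).toReal ≤ δ := ENNReal.toReal_le_of_le_ofReal hδ ((hsT z).trans hsz)
  refine ⟨z, max_le ?_ ?_⟩
  · linarith [(hz (T z)).2]
  · change d (T z) z ≤ 2 * δ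
    linarith [(hz (T z)).1]
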